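/- Let $G$ be a finite connected simple undirected graph and let $v^*$ be a vertex of $G$. Let $\hat A(G,v^*)$ denote the adjacency matrix of $G$, modified by putting $-1$ in the diagonal position corresponding to $v^*$. Then the smallest eigenvalue of $\hat A(G,v^*)$ is greater than $-2$ if and only if $G$ is the line graph of a finite tree $T$ and $v^*$ corresponds to an end edge of $T$; that is, there are a finite tree $T$ and a graph isomorphism $\varphi$ from $G$ to the line graph $L(T)$ such that the edge $\varphi(v^*)$ of $T$ is incident with a vertex of degree $1$. -/

import Mathlib

universe u

/-- The matrix `Â(G, v)`: the adjacency matrix of `G` with the entry in the diagonal position of the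
vertex `v` replaced by `-1`. -/
def modifiedAdjMatrix {V : Type u} [DecidableEq V] (G : SimpleGraph V) [DecidableRel G.Adj]
    (v : V) : Matrix V V ℝ :=
  Matrix.of fun i j => if i = v ∧ j = v then -1 else G.adjMatrix ℝ i j

theorem modifiedAdjMatrix_isHermitian {V : Type u} [DecidableEq V] (G : SimpleGraph V)
    [DecidableRel G.Adj] (v : V) : (modifiedAdjMatrix G v).IsHermitian := by
  ext i j
  simp [modifiedAdjMatrix, Matrix.conjTranspose_apply, SimpleGraph.adjMatrix_apply, G.adj_comm,
    and_comm]

/-- The smallest eigenvalue of a real symmetric matrix: the minimum of the finite family of its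
eigenvalues (attained as soon as the index type is non-empty). -/
noncomputable def smallestEigenvalue {V : Type u} [Fintype V] [DecidableEq V]
    {A : Matrix V V ℝ} (hA : A.IsHermitian) : ℝ :=
  ⨅ i, hA.eigenvalues i

/-- An edge `e` of `T` is an end edge if one of its two ends is a leaf, that is, a vertex with
exactly one neighbor. -/
def IsEndEdge {W : Type u} (T : SimpleGraph W) (e : T.edgeSet) : Prop :=
  ∃ w ∈ (e : Sym2 W), (T.neighborSet w).ncard = 1

/-!
The matrix `Â(G, v) + 2I` is integral, with diagonal entries `2` except for a `1` at `v`, and the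
smallest eigenvalue of `Â(G, v)` exceeds `-2` exactly when it is positive definite
(`neg_two_lt_smallestEigenvalue_iff`).

If `G` is the line graph of a tree and `v` is an edge with a leaf `w`, this matrix is `B * Bᵀ`, where
`B` is the edge-vertex incidence matrix with the column of `w` removed. A tree has one edge fewer
than it has vertices, so `B` is square, and connectedness makes it invertible (`posDef_of_isTree`).

Conversely, a positive definite matrix `Â(G, v) + 2I` turns `ℤ^V` into an integral lattice, generated
by the standard basis vectors: one of norm `1` and the others of norm `2`. In such a lattice two unit
vectors are equal, opposite or orthogonal, and a vector of norm `2` that is not orthogonal to some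
unit vector is a sum of two orthogonal unit vectors. Starting from `v`, unit vectors therefore spread
along the edges of the connected graph `G`, so the lattice is `ℤ^n` with its standard form, where
`n` is the number of vertices, and each vertex other than `v` is a signed sum of two coordinate
vectors (`IsOrthonormalSet.exists_support_of_norm_two`). Take the coordinates and one extra vertex
as the vertices of a graph `T`, where a vertex of `G` gives the edge joining its two coordinates and
`v` gives the edge joining its only coordinate to the extra vertex. Then `T` is connected with
`n + 1` vertices and at most `n` edges, so it is a tree with one edge for each vertex of `G`. Two
distinct edges then share at most one end, so that their inner product is nonzero exactly when they
meet, and `G` is the line graph of `T` (`exists_tree_of_coordinates`).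
-/

/-! ### Unit vectors of a positive definite integral form -/

section IntegralForm

variable {L : Type*} [AddCommGroup L] {q : LinearMap.BilinForm ℤ L}

theorem eq_or_eq_neg_of_form_ne_zero (hs : q.IsSymm) (hp : ∀ x ≠ 0, 0 < q x x) {f g : L}
    (hf : q f f = 1) (hg : q g g = 1) (h : q f g ≠ 0) : f = g ∨ f = -g := by
  by_contra! hne
  have h1 := hp (f - g) (sub_ne_zero.2 hne.1)
  have h2 := hp (f + g) (fun h0 => hne.2 (eq_neg_of_add_eq_zero_left h0))
  have hc : q g f = q f g := hs.eq g f
  simp only [map_sub, map_add, LinearMap.sub_apply, LinearMap.add_apply, hf, hg, hc] at h1 h2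
  omega

/-- By Cauchy–Schwarz a unit vector that is not orthogonal to a vector `x` of norm `2` has inner
product `±1` with `x`, and removing this component from `x` leaves another unit vector. -/
theorem exists_unit_add_of_form_ne_zero (hs : q.IsSymm) (hp : ∀ x ≠ 0, 0 < q x x) {f x : L}
    (hf : q f f = 1) (hx : q x x = 2) (h : q f x ≠ 0) :
    ∃ (a : ℤ) (g : L), q g g = 1 ∧ q f g = 0 ∧ x = a • f + g := by
  have hc : q x f = q f x := hs.eq x f
  set c := q f x with hcdef
  have hsq : c * c ≠ 2 := by
    intro h2
    have h3 : c < 2 := by nlinarith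
    have h4 : -2 < c := by nlinarith
    interval_cases c <;> omega
  have key : q (x - c • f) (x - c • f) = 2 - c * c := by
    simp only [map_sub, LinearMap.sub_apply, map_smul, LinearMap.smul_apply, hf, hx, hc, ← hcdef,
      smul_eq_mul]
    ring
  have hne : x - c • f ≠ 0 := by
    intro h0
    rw [h0] at key
    simp only [map_zero] at key
    omega
  have hpos := hp _ hne
  rw [key] at hpos
  have hcc : c * c = 1 := by
    have h3 : c < 2 := by nlinarith
    have h4 : -2 < c := by nlinarith
    interval_cases c <;> omega
  refine ⟨c, x - c • f, by rw [key, hcc]; norm_num, ?_, by abel⟩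
  simp only [map_sub, map_smul, hf, ← hcdef, smul_eq_mul]
  ring

/-- A set of pairwise orthogonal vectors of norm `1` for an integral bilinear form. -/
def IsOrthonormalSet (q : LinearMap.BilinForm ℤ L) (S : Set L) : Prop :=
  (∀ s ∈ S, q s s = 1) ∧ ∀ s ∈ S, ∀ t ∈ S, s ≠ t → q s t = 0

/-- A maximal orthonormal set contains every unit vector up to sign, since unit vectors are equal,
opposite or orthogonal. -/
theorem exists_isOrthonormalSet_forall_unit (hs : q.IsSymm) (hp : ∀ x ≠ 0, 0 < q x x) :
    ∃ S : Set L, IsOrthonormalSet q S ∧ ∀ f, q f f = 1 → ∃ s ∈ S, f = s ∨ f = -s := by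
  obtain ⟨S, hS⟩ := zorn_subset {S : Set L | IsOrthonormalSet q S} (by
    intro c hc hchain
    refine ⟨⋃₀ c, ⟨?_, ?_⟩, fun s hs => Set.subset_sUnion_of_mem hs⟩
    · rintro s ⟨A, hA, hsA⟩
      exact (hc hA).1 s hsA
    · rintro s ⟨A, hA, hsA⟩ t ⟨B, hB, htB⟩ hst
      rcases hchain.total hA hB with h | h
      · exact (hc hB).2 s (h hsA) t htB hst
      · exact (hc hA).2 s hsA t (h htB) hst)
  refine ⟨S, hS.prop, fun f hf => ?_⟩
  by_contra! hcon
  have horth : ∀ s ∈ S, q f s = 0 := by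
    intro s hsS
    by_contra h0
    rcases eq_or_eq_neg_of_form_ne_zero hs hp hf (hS.prop.1 s hsS) h0 with h | h
    · exact (hcon s hsS).1 h
    · exact (hcon s hsS).2 h
  have hins : IsOrthonormalSet q (insert f S) := by
    refine ⟨?_, ?_⟩
    · rintro s (rfl | hsS)
      · exact hf
      · exact hS.prop.1 s hsS
    · rintro s (rfl | hsS) t (rfl | htS) hst
      · exact absurd rfl hst
      · exact horth t htS
      · exact (hs.eq _ _).symm.trans (horth s hsS)
      · exact hS.prop.2 s hsS t htS hst
  exact (hcon f (hS.le_of_ge hins (Set.subset_insert f S) (Set.mem_insert f S))).1 rfl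

theorem IsOrthonormalSet.form_sum {S : Set L} (hS : IsOrthonormalSet q S) (s : S)
    (t : Finset S) (g : S → ℤ) (hst : s ∈ t) : q s (∑ i ∈ t, g i • (i : L)) = g s := by
  rw [map_sum, Finset.sum_eq_single s]
  · simp [hS.1 s s.2]
  · intro r _ hr
    simp [hS.2 s s.2 r r.2 (fun h => hr (Subtype.ext h.symm))]
  · exact fun h => absurd hst h

theorem IsOrthonormalSet.linearIndependent {S : Set L} (hS : IsOrthonormalSet q S) :
    LinearIndependent ℤ ((↑) : S → L) := by
  rw [linearIndependent_iff']
  intro t g hg s hst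
  rw [← hS.form_sum s t g hst, hg, map_zero]

theorem IsOrthonormalSet.form_eq_sum {S : Set L} [Fintype S] (hS : IsOrthonormalSet q S)
    (hspan : Submodule.span ℤ S = ⊤) (x y : L) : q x y = ∑ s : S, q s x * q s y := by
  have hx : x ∈ Submodule.span ℤ S := hspan ▸ Submodule.mem_top
  induction hx using Submodule.span_induction with
  | mem x hx =>
    rw [Finset.sum_eq_single ⟨x, hx⟩]
    · simp [hS.1 x hx]
    · intro r _ hr
      simp [hS.2 r r.2 x hx (fun h => hr (Subtype.ext h))]
    · simp
  | zero => simp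
  | add x z _ _ h1 h2 => simp [h1, h2, add_mul, Finset.sum_add_distrib]
  | smul a x _ h => simp [h, Finset.mul_sum, mul_assoc]

variable {S : Set L}

/-- A unit vector is, up to sign, one element of a maximal orthonormal set. -/
theorem IsOrthonormalSet.exists_support_of_norm_one (hS : IsOrthonormalSet q S)
    (hmax : ∀ f, q f f = 1 → ∃ s ∈ S, f = s ∨ f = -s) {x : L} (hx : q x x = 1) :
    x ∈ Submodule.span ℤ S ∧ ∃ s : S, ∀ r : S, q r x ≠ 0 ↔ r = s := by
  obtain ⟨s, hsS, h⟩ := hmax x hx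
  have hspan := Submodule.subset_span (R := ℤ) hsS
  refine ⟨?_, ⟨s, hsS⟩, fun r => ?_⟩
  · rcases h with rfl | rfl
    · exact hspan
    · exact neg_mem hspan
  · have : q r x ≠ 0 ↔ q r s ≠ 0 := by rcases h with rfl | rfl <;> simp
    rw [this]
    constructor
    · intro h1
      by_contra h2
      exact h1 (hS.2 r r.2 s hsS (fun h3 => h2 (Subtype.ext h3)))
    · rintro rfl
      simp [hS.1 s hsS]

/-- A vector of norm `2` that is not orthogonal to all unit vectors is a signed sum of two distinct
elements of a maximal orthonormal set. -/
theorem IsOrthonormalSet.exists_support_of_norm_two (hs : q.IsSymm) (hp : ∀ x ≠ 0, 0 < q x x)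
    (hS : IsOrthonormalSet q S) (hmax : ∀ f, q f f = 1 → ∃ s ∈ S, f = s ∨ f = -s) {f x : L}
    (hx : q x x = 2) (hf : q f f = 1) (hfx : q f x ≠ 0) :
    x ∈ Submodule.span ℤ S ∧ ∃ s t : S, s ≠ t ∧ ∀ r : S, q r x ≠ 0 ↔ r = s ∨ r = t := by
  obtain ⟨a, g, hg, hfg, rfl⟩ := exists_unit_add_of_form_ne_zero hs hp hf hx hfx
  obtain ⟨hf1, s, hsup⟩ := hS.exists_support_of_norm_one hmax hf
  obtain ⟨hg1, t, htup⟩ := hS.exists_support_of_norm_one hmax hg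
  have ha : a ≠ 0 := by
    rintro rfl
    simp [hfg] at hfx
  have hst : s ≠ t := by
    rintro rfl
    obtain ⟨f', hf', h1⟩ := hmax f hf
    obtain ⟨g', hg', h2⟩ := hmax g hg
    have e1 : (⟨f', hf'⟩ : S) = s := (hsup _).1 (by rcases h1 with rfl | rfl <;> simp [hS.1 _ hf'])
    have e2 : (⟨g', hg'⟩ : S) = s := (htup _).1 (by rcases h2 with rfl | rfl <;> simp [hS.1 _ hg'])
    have e3 : f' = g' := by rw [← e2] at e1; exact congrArg Subtype.val e1
    subst e3
    rcases h1 with rfl | rfl <;> rcases h2 with rfl | rfl <;> simp_all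
  refine ⟨add_mem (Submodule.smul_mem _ _ hf1) hg1, s, t, hst, fun r => ?_⟩
  simp only [map_add, map_smul, smul_eq_mul]
  by_cases hrs : r = s
  · subst hrs
    have h0 : q r g = 0 := by
      by_contra h
      exact hst ((htup r).1 h)
    simp [h0, ha, (hsup r).2 rfl]
  · have h0 : q r f = 0 := by
      by_contra h
      exact hrs ((hsup r).1 h)
    simp only [h0, mul_zero, zero_add, hrs, false_or]
    exact htup r

end IntegralForm

/-! ### The smallest eigenvalue and the Gram matrix -/

section GramMatrix

variable {V : Type u} [DecidableEq V] (G : SimpleGraph V) [DecidableRel G.Adj] (v : V)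

/-- The integral matrix `Â(G, v) + 2I`: its diagonal entries are `2`, except for the entry `1` at
`v`, and its other entries are those of the adjacency matrix. -/
def gramMatrix : Matrix V V ℤ :=
  Matrix.of fun i j => if i = j then (if i = v then 1 else 2) else if G.Adj i j then 1 else 0

theorem gramMatrix_isSymm : (gramMatrix G v).IsSymm := by
  ext i j
  by_cases h : i = j
  · subst h; rfl
  · simp [gramMatrix, h, Ne.symm h, G.adj_comm]

theorem gramMatrix_map_eq [Fintype V] :
    (gramMatrix G v).map ((↑) : ℤ → ℝ) =
      algebraMap ℝ (Matrix V V ℝ) 2 + modifiedAdjMatrix G v := by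
  ext i j
  by_cases h : i = j
  · subst h
    by_cases hv : i = v
    · simp [gramMatrix, modifiedAdjMatrix, hv, Matrix.algebraMap_matrix_apply]; norm_num
    · simp [gramMatrix, modifiedAdjMatrix, hv, Matrix.algebraMap_matrix_apply]
  · have : ¬ (i = v ∧ j = v) := fun h' => h (h'.1.trans h'.2.symm)
    simp [gramMatrix, modifiedAdjMatrix, h, this, Matrix.algebraMap_matrix_apply,
      SimpleGraph.adjMatrix_apply]

theorem neg_two_lt_smallestEigenvalue_iff [Fintype V] [Nonempty V] :
    -2 < smallestEigenvalue (modifiedAdjMatrix_isHermitian G v) ↔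
      ((gramMatrix G v).map ((↑) : ℤ → ℝ)).PosDef := by
  have hH : ((gramMatrix G v).map ((↑) : ℤ → ℝ)).IsHermitian := by
    ext i j
    simp [Matrix.conjTranspose_apply, (gramMatrix_isSymm G v).apply]
  have hA := modifiedAdjMatrix_isHermitian G v
  have h1 : -2 < smallestEigenvalue hA ↔ ∀ i, -2 < hA.eigenvalues i := by
    refine ⟨fun h i => h.trans_le (ciInf_le (Set.finite_range _).bddBelow i), fun h => ?_⟩
    obtain ⟨i, hi⟩ := exists_eq_ciInf_of_finite (f := hA.eigenvalues)
    rw [smallestEigenvalue, ← hi]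
    exact h i
  have h2 : (∀ i, -2 < hA.eigenvalues i) ↔ ∀ r ∈ spectrum ℝ (modifiedAdjMatrix G v), -2 < r := by
    rw [hA.spectrum_real_eq_range_eigenvalues, Set.forall_mem_range]
  have h3 : (∀ i, 0 < hH.eigenvalues i) ↔
      ∀ r ∈ spectrum ℝ ((gramMatrix G v).map ((↑) : ℤ → ℝ)), 0 < r := by
    rw [hH.spectrum_real_eq_range_eigenvalues, Set.forall_mem_range]
  rw [h1, h2, hH.posDef_iff_eigenvalues_pos, h3, gramMatrix_map_eq]
  constructor
  · intro h r hr
    have := h (r - 2) (by rw [← spectrum.add_mem_add_iff (s := 2), sub_add_cancel]; exact hr)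
    linarith
  · intro h r hr
    have := h (r + 2) (spectrum.add_mem_add_iff.2 hr)
    linarith

theorem toBilin'_gramMatrix_pos [Fintype V]
    (h : ((gramMatrix G v).map ((↑) : ℤ → ℝ)).PosDef) (x : V → ℤ) (hx : x ≠ 0) :
    0 < (gramMatrix G v).toBilin' x x := by
  have hx' : (fun i => (x i : ℝ)) ≠ 0 := fun h0 => hx (funext fun i => by
    simpa using congrFun h0 i)
  have := h.dotProduct_mulVec_pos hx'
  rw [Matrix.toBilin'_apply']
  simp only [dotProduct, Matrix.mulVec, Matrix.map_apply, Pi.star_apply, star_trivial] at this ⊢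
  exact_mod_cast this

/-- No standard basis vector is orthogonal to all unit vectors: this holds for the basis vector of
`v`, which is itself a unit vector, and it spreads along the edges of the connected graph `G`. If
the basis vector of `w` is a sum of two orthogonal unit vectors and `u` is adjacent to `w`, then one
of the two summands is not orthogonal to the basis vector of `u`. -/
theorem exists_unit_form_single_ne_zero [Fintype V] (hG : G.Connected)
    (h : ((gramMatrix G v).map ((↑) : ℤ → ℝ)).PosDef) (u : V) :
    ∃ f, (gramMatrix G v).toBilin' f f = 1 ∧
      (gramMatrix G v).toBilin' f (Pi.single u 1) ≠ 0 := by
  have hp := toBilin'_gramMatrix_pos G v h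
  have hs : (gramMatrix G v).toBilin'.IsSymm :=
    Matrix.isSymm_toBilin'_iff_isSymm.2 (gramMatrix_isSymm G v)
  have hr := (SimpleGraph.reachable_iff_reflTransGen v u).1 (hG.preconnected v u)
  have hone : ∀ w, (gramMatrix G v).toBilin' (Pi.single w 1) (Pi.single w 1) =
      if w = v then 1 else 2 := fun w => by
    rw [Matrix.toBilin'_single]; simp [gramMatrix]
  induction hr with
  | refl =>
    refine ⟨Pi.single v 1, ?_, ?_⟩ <;> simp [hone]
  | @tail w u _ hwu ih =>
    obtain ⟨f, hf, hfw⟩ := ih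
    have hadj : (gramMatrix G v).toBilin' (Pi.single w 1) (Pi.single u 1) = 1 := by
      rw [Matrix.toBilin'_single]; simp [gramMatrix, hwu.ne, hwu]
    by_cases hwv : w = v
    · refine ⟨Pi.single w 1, by simp [hone, hwv], by simp [hadj]⟩
    · obtain ⟨a, g, hg, -, hw⟩ := exists_unit_add_of_form_ne_zero hs hp hf
        ((hone w).trans (if_neg hwv)) hfw
      by_cases hfu : (gramMatrix G v).toBilin' f (Pi.single u 1) = 0
      · refine ⟨g, hg, fun hgu => ?_⟩
        rw [hw, map_add, LinearMap.add_apply, hgu, map_smul, LinearMap.smul_apply, hfu] at hadj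
        simp at hadj
      · exact ⟨f, hf, hfu⟩

end GramMatrix

/-! ### From orthonormal coordinates to a tree -/

section TreeOfCoordinates

variable {V : Type u} [Fintype V] [DecidableEq V] {G : SimpleGraph V} [DecidableRel G.Adj] {v : V}

/-- Let the rows of `Â(G, v) + 2I` be realised by integral vectors in as many coordinates as there
are vertices, the vector of `v` having one nonzero coordinate and all others having two. Joining
the two coordinates of each vertex by an edge, and the coordinate of `v` to an extra vertex `none`,
gives a connected graph. Counting its vertices and edges shows that it is a tree and that distinct
vertices of `G` give distinct edges. -/
theorem exists_tree_of_coordinates (hG : G.Connected) {S : Type u} [Fintype S] (C : S → V → ℤ)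
    (hgram : ∀ u w, gramMatrix G v u w = ∑ s, C s u * C s w)
    (hcard : Fintype.card V ≤ Fintype.card S) (htouch : ∀ s, ∃ u, C s u ≠ 0)
    (hv : ∃ s, ∀ r, C r v ≠ 0 ↔ r = s)
    (hu : ∀ u ≠ v, ∃ s t, s ≠ t ∧ ∀ r, C r u ≠ 0 ↔ r = s ∨ r = t) :
    ∃ (W : Type u) (_ : Finite W) (T : SimpleGraph W) (φ : G ≃g T.lineGraph),
      T.IsTree ∧ IsEndEdge T (φ v) := by
  classical
  have hends : ∀ u, ∃ e : Sym2 (Option S), ¬ e.IsDiag ∧ (∀ r, some r ∈ e ↔ C r u ≠ 0) ∧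
      (none ∈ e ↔ u = v) := by
    intro u
    by_cases huv : u = v
    · obtain ⟨s, hs⟩ := hv
      exact ⟨s(some s, none), by simp, by simp [huv, hs], by simp [huv]⟩
    · obtain ⟨s, t, hst, h⟩ := hu u huv
      exact ⟨s(some s, some t), by simpa using hst, by simp [h], by simp [huv]⟩
  choose e hdiag hsome hnone using hends
  -- Adjacent vertices have nonzero inner product, hence a common coordinate.
  have hshare : ∀ u w, G.Adj u w → ∃ r, some r ∈ e u ∧ some r ∈ e w := by
    intro u w huw
    have h1 : ∑ s, C s u * C s w ≠ 0 := by
      rw [← hgram]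
      simp [gramMatrix, huw.ne, huw]
    obtain ⟨r, -, hr⟩ := Finset.exists_ne_zero_of_sum_ne_zero h1
    exact ⟨r, (hsome u r).2 (left_ne_zero_of_mul hr), (hsome w r).2 (right_ne_zero_of_mul hr)⟩
  set T : SimpleGraph (Option S) := SimpleGraph.fromEdgeSet (Set.range e) with hT
  have hTe : T.edgeSet = Set.range e := by
    rw [hT, SimpleGraph.edgeSet_fromEdgeSet]
    ext x
    simp only [Set.mem_sdiff, Set.mem_range]
    refine ⟨fun h => h.1, ?_⟩
    rintro ⟨u, rfl⟩
    exact ⟨⟨u, rfl⟩, hdiag u⟩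
  have hreach1 : ∀ u a b, a ∈ e u → b ∈ e u → T.Reachable a b := by
    intro u a b ha hb
    by_cases hab : a = b
    · exact hab ▸ SimpleGraph.Reachable.refl _
    · refine SimpleGraph.Adj.reachable ?_
      rw [← SimpleGraph.mem_edgeSet, hTe]
      exact ⟨u, (Sym2.mem_and_mem_iff hab).1 ⟨ha, hb⟩⟩
  have hreach : ∀ u, ∀ a ∈ e u, T.Reachable none a := by
    intro u
    have hr := (SimpleGraph.reachable_iff_reflTransGen v u).1 (hG.preconnected v u)
    induction hr with
    | refl => exact fun a ha => hreach1 v _ _ ((hnone v).2 rfl) ha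
    | @tail w u _ hwu ih =>
      obtain ⟨r, hr1, hr2⟩ := hshare w u hwu
      exact fun a ha => (ih _ hr1).trans (hreach1 u _ _ hr2 ha)
  have hconn : T.Connected := by
    refine SimpleGraph.connected_iff_exists_forall_reachable _ |>.2 ⟨none, ?_⟩
    rintro (_ | s)
    · exact SimpleGraph.Reachable.refl _
    · obtain ⟨u, hsu⟩ := htouch s
      exact hreach u _ ((hsome u s).2 hsu)
  have hcardE : Nat.card T.edgeSet ≤ Fintype.card V := by
    rw [hTe, ← Nat.card_eq_fintype_card]
    exact Finite.card_range_le e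
  have hcardW : Nat.card (Option S) = Fintype.card S + 1 := by simp
  have hle := hconn.card_vert_le_card_edgeSet_add_one
  have hcardE' : Nat.card T.edgeSet = Fintype.card V := by omega
  have htree : T.IsTree := SimpleGraph.isTree_iff_connected_and_card.2 ⟨hconn, by omega⟩
  let φ₀ : V → T.edgeSet := fun u => ⟨e u, hTe ▸ ⟨u, rfl⟩⟩
  have hsurj : Function.Surjective φ₀ := by
    rintro ⟨x, hx⟩
    have hx' := hx
    rw [hTe] at hx'
    obtain ⟨u, rfl⟩ := hx'
    exact ⟨u, rfl⟩
  have hbij : Function.Bijective φ₀ := by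
    refine hsurj.bijective_of_nat_card_le ?_
    rw [hcardE', Nat.card_eq_fintype_card]
  have hinj : Function.Injective e := fun u w h => hbij.1 (Subtype.ext h)
  let φ : G ≃g T.lineGraph := {
    toEquiv := Equiv.ofBijective φ₀ hbij
    map_rel_iff' := by
      intro u w
      rw [SimpleGraph.lineGraph_adj_iff_exists]
      change (φ₀ u ≠ φ₀ w ∧ ∃ a, a ∈ e u ∧ a ∈ e w) ↔ G.Adj u w
      constructor
      · rintro ⟨hne, a, hau, haw⟩
        have huw : u ≠ w := fun h => hne (congrArg φ₀ h)
        by_contra hadj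
        rcases a with _ | r
        · exact huw (((hnone u).1 hau).trans ((hnone w).1 haw).symm)
        -- Distinct edges share only the coordinate `r`, so the inner product is nonzero.
        · have h0 := hgram u w
          rw [Finset.sum_eq_single r] at h0
          · simp only [gramMatrix, Matrix.of_apply, huw, hadj, if_false] at h0
            exact mul_ne_zero ((hsome u r).1 hau) ((hsome w r).1 haw) h0.symm
          · intro s _ hsr
            by_contra hs
            refine huw (hinj (Sym2.eq_of_ne_mem (x := some s) (y := some r) (by simpa using hsr)
              ((hsome u s).2 (left_ne_zero_of_mul hs)) hau
              ((hsome w s).2 (right_ne_zero_of_mul hs)) haw))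
          · simp
      · intro h
        obtain ⟨r, h1, h2⟩ := hshare u w h
        exact ⟨fun h' => h.ne (hbij.1 h'), some r, h1, h2⟩ }
  refine ⟨Option S, inferInstance, T, φ, htree, none, (hnone v).2 rfl, ?_⟩
  obtain ⟨s, hs⟩ := hv
  have hev : e v = s(none, some s) :=
    ((Sym2.mem_and_mem_iff (by simp)).1 ⟨(hnone v).2 rfl, (hsome v s).2 ((hs s).2 rfl)⟩)
  rw [Set.ncard_eq_one]
  refine ⟨some s, ?_⟩
  ext a
  rw [SimpleGraph.mem_neighborSet, ← SimpleGraph.mem_edgeSet, hTe, Set.mem_singleton_iff]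
  constructor
  · rintro ⟨u, hu⟩
    have huv : u = v := (hnone u).1 (hu ▸ Sym2.mem_mk_left _ _)
    rw [huv, hev] at hu
    exact (Sym2.congr_right.1 hu).symm
  · rintro rfl
    exact ⟨v, hev⟩

theorem exists_tree_of_posDef (hG : G.Connected)
    (h : ((gramMatrix G v).map ((↑) : ℤ → ℝ)).PosDef) :
    ∃ (W : Type u) (_ : Finite W) (T : SimpleGraph W) (φ : G ≃g T.lineGraph),
      T.IsTree ∧ IsEndEdge T (φ v) := by
  classical
  have hp := toBilin'_gramMatrix_pos G v h
  have hs : (gramMatrix G v).toBilin'.IsSymm :=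
    Matrix.isSymm_toBilin'_iff_isSymm.2 (gramMatrix_isSymm G v)
  obtain ⟨S, hS, hmax⟩ := exists_isOrthonormalSet_forall_unit hs hp
  have hone : ∀ w, (gramMatrix G v).toBilin' (Pi.single w 1) (Pi.single w 1) =
      if w = v then 1 else 2 := fun w => by
    rw [Matrix.toBilin'_single]; simp [gramMatrix]
  have hsv := hS.exists_support_of_norm_one hmax ((hone v).trans (if_pos rfl))
  have hsu : ∀ u ≠ v, _ := fun u (hu : u ≠ v) =>
    have ⟨_, hf, hfu⟩ := exists_unit_form_single_ne_zero G v hG h u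
    hS.exists_support_of_norm_two hs hp hmax ((hone u).trans (if_neg hu)) hf hfu
  have hspan : Submodule.span ℤ S = ⊤ := by
    rw [eq_top_iff, ← (Pi.basisFun ℤ V).span_eq, Submodule.span_le]
    rintro _ ⟨u, rfl⟩
    rw [Pi.basisFun_apply]
    by_cases hu : u = v
    · exact hu ▸ hsv.1
    · exact (hsu u hu).1
  have : Finite S := hS.linearIndependent.finite
  have := Fintype.ofFinite S
  refine exists_tree_of_coordinates hG
    (fun (s : S) u => (gramMatrix G v).toBilin' s (Pi.single u 1)) ?_ ?_ ?_ hsv.2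
    fun u hu => (hsu u hu).2
  · intro u w
    rw [← hS.form_eq_sum hspan, Matrix.toBilin'_single]
  · have := finrank_le_of_span_eq_top (R := ℤ) (v := ((↑) : S → V → ℤ)) (by simpa using hspan)
    simpa using this
  · intro s
    by_contra! h0
    have hzero : (gramMatrix G v).toBilin' s = 0 := LinearMap.pi_ext' fun u => by
      ext
      simpa using h0 u
    have := hS.1 s s.2
    simp [hzero] at this

end TreeOfCoordinates

/-! ### From a tree to a positive definite matrix -/

section PosDefOfTree

theorem sum_ite_mem_sym2 {W : Type*} [Fintype W] [DecidableEq W] {x y : W} (hxy : x ≠ y)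
    (f : W → ℝ) : (∑ a, if a ∈ s(x, y) then f a else 0) = f x + f y := by
  rw [Finset.sum_eq_add x y hxy]
  · simp
  · rintro c - ⟨h1, h2⟩
    simp [h1, h2]
  · simp
  · simp

variable {V : Type u} [Fintype V] [DecidableEq V] {G : SimpleGraph V} [DecidableRel G.Adj] {v : V}

/-- Let `w` be a leaf of the tree `T` on the edge `φ v`. The edge-vertex incidence matrix of `T` with
the column of `w` removed is square. It is invertible, because a function on the vertices that
vanishes at `w` and takes opposite values at the ends of each edge vanishes on the connected graph
`T`. Its Gram matrix of rows is `Â(G, v) + 2I`. -/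
theorem posDef_of_isTree {W : Type u} [Finite W] {T : SimpleGraph W} (φ : G ≃g T.lineGraph)
    (hT : T.IsTree) (hend : IsEndEdge T (φ v)) :
    ((gramMatrix G v).map ((↑) : ℤ → ℝ)).PosDef := by
  classical
  have := Fintype.ofFinite W
  obtain ⟨w, hwv, hw⟩ := hend
  -- The leaf `w` lies on no edge other than `φ v`.
  have huniq : ∀ u, w ∈ (φ u : Sym2 W) → u = v := by
    obtain ⟨b, hb⟩ := Set.ncard_eq_one.1 hw
    have key : ∀ u, w ∈ (φ u : Sym2 W) → (φ u : Sym2 W) = s(w, b) := by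
      intro u hu
      obtain ⟨c, hc⟩ := hu
      have hadj : T.Adj w c := by
        rw [← SimpleGraph.mem_edgeSet, ← hc]
        exact (φ u).2
      have hcb : c ∈ T.neighborSet w := hadj
      rw [hb] at hcb
      rw [hc, Set.mem_singleton_iff.1 hcb]
    exact fun u hu => φ.injective (Subtype.ext ((key u hu).trans (key v hwv).symm))
  have hedge : ∀ u, ∃ x y, x ≠ y ∧ (φ u : Sym2 W) = s(x, y) := by
    intro u
    have h2 := (φ u).2
    generalize (φ u : Sym2 W) = e at h2
    induction e with
    | h x y => exact ⟨x, y, T.ne_of_adj h2, rfl⟩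
  have hcard : Fintype.card {a // a ≠ w} = Fintype.card V := by
    have h1 := (SimpleGraph.isTree_iff_connected_and_card.1 hT).2
    have h2 := Nat.card_congr φ.toEquiv
    rw [Nat.card_eq_fintype_card] at h1 h2
    rw [Nat.card_eq_fintype_card] at h1
    have h3 : Fintype.card {a // a ≠ w} = Fintype.card W - 1 := by simp
    rw [Nat.card_eq_fintype_card] at h2
    omega
  let σ : {a // a ≠ w} ≃ V := Fintype.equivOfCardEq hcard
  let N : Matrix V {a // a ≠ w} ℝ := Matrix.of fun u a => if (a : W) ∈ (φ u : Sym2 W) then 1 else 0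
  let B : Matrix V V ℝ := N.submatrix id σ.symm
  have hgram : (gramMatrix G v).map ((↑) : ℤ → ℝ) = B * B.conjTranspose := by
    ext u u'
    have h1 : (B * B.conjTranspose) u u' = ∑ a : {a // a ≠ w}, N u a * N u' a := by
      rw [Matrix.mul_apply, ← σ.sum_comp]
      simp [B, Matrix.conjTranspose_apply]
    have h2 := Fintype.sum_eq_add_sum_subtype_ne
      (fun a => if a ∈ (φ u : Sym2 W) then (if a ∈ (φ u' : Sym2 W) then (1 : ℝ) else 0) else 0) w
    have h3 : ∑ a : {a // a ≠ w}, N u a * N u' a = ∑ a : {a // a ≠ w},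
        if (a : W) ∈ (φ u : Sym2 W) then (if (a : W) ∈ (φ u' : Sym2 W) then (1 : ℝ) else 0) else 0 :=
      Finset.sum_congr rfl fun a _ => by
        simp only [N, Matrix.of_apply, ite_mul, one_mul, zero_mul]
    obtain ⟨x, y, hxy, hu⟩ := hedge u
    rw [h1, h3, ← sub_eq_iff_eq_add'.2 h2, hu, sum_ite_mem_sym2 hxy, ← hu]
    by_cases huu : u = u'
    · subst huu
      have hx : x ∈ (φ u : Sym2 W) := hu ▸ Sym2.mem_mk_left x y
      have hy : y ∈ (φ u : Sym2 W) := hu ▸ Sym2.mem_mk_right x y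
      by_cases huv : u = v
      · subst huv
        norm_num [gramMatrix, hwv, hx, hy]
      · have hwu : w ∉ (φ u : Sym2 W) := fun h => huv (huniq u h)
        norm_num [gramMatrix, huv, hwu, hx, hy]
    · have hww : w ∈ (φ u : Sym2 W) → w ∉ (φ u' : Sym2 W) := fun h h' =>
        huu ((huniq u h).trans (huniq u' h').symm)
      have hne : φ u ≠ φ u' := fun h => huu (φ.injective h)
      have hadj := SimpleGraph.lineGraph_adj_iff_exists.symm.trans (φ.map_rel_iff' (a := u) (b := u'))
      -- Distinct edges do not share both ends.
      have hnot : ¬ (x ∈ (φ u' : Sym2 W) ∧ y ∈ (φ u' : Sym2 W)) := fun h =>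
        hne (Subtype.ext (hu.trans ((Sym2.mem_and_mem_iff hxy).1 h).symm))
      have hadj' : G.Adj u u' ↔ x ∈ (φ u' : Sym2 W) ∨ y ∈ (φ u' : Sym2 W) := by
        rw [← hadj]
        simp only [RelIso.coe_fn_toEquiv]
        rw [hu]
        simp [hne]
      have hw0 : (if w ∈ (φ u : Sym2 W) then
          (if w ∈ (φ u' : Sym2 W) then (1 : ℝ) else 0) else 0) = 0 := by
        split_ifs with h h'
        · exact absurd h' (hww h)
        · rfl
        · rfl
      rw [hw0]
      simp only [gramMatrix, Matrix.map_apply, Matrix.of_apply, huu, if_false, hadj']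
      by_cases hx : x ∈ (φ u' : Sym2 W) <;> by_cases hy : y ∈ (φ u' : Sym2 W) 
      · exact absurd ⟨hx, hy⟩ hnot
      all_goals simp [hx, hy]
  have hker : ∀ z : {a // a ≠ w} → ℝ, N.mulVec z = 0 → z = 0 := by
    intro z hz
    let z' : W → ℝ := fun a => if h : a ≠ w then z ⟨a, h⟩ else 0
    have hz'w : z' w = 0 := by simp [z']
    have hopp : ∀ a b, T.Adj a b → z' a + z' b = 0 := by
      intro a b hab
      obtain ⟨u, hu⟩ := φ.surjective ⟨s(a, b), hab⟩
      have h1 := Fintype.sum_eq_add_sum_subtype_ne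
        (fun c => if c ∈ s(a, b) then z' c else 0) w
      have h2 : ∑ c : {c // c ≠ w}, (if (c : W) ∈ s(a, b) then z' c else 0) = N.mulVec z u := by
        refine Finset.sum_congr rfl fun c _ => ?_
        simp only [N, Matrix.of_apply, hu, z', ite_mul, one_mul, zero_mul]
        rw [dif_pos c.2]
      rw [h2, hz, sum_ite_mem_sym2 hab.ne] at h1
      simpa [hz'w] using h1
    have hzero : ∀ a, z' a = 0 := by
      intro a
      have hr := (SimpleGraph.reachable_iff_reflTransGen w a).1 (hT.connected.preconnected w a)
      induction hr with
      | refl => exact hz'w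
      | @tail b c _ hbc ih => simpa [ih] using hopp b c hbc
    ext a
    simpa [z', a.2] using hzero a
  have hB : Function.Injective B.mulVec := by
    rw [← Matrix.coe_mulVecLin, injective_iff_map_eq_zero]
    intro y hy
    have h0 : N.mulVec (y ∘ σ) = 0 := by
      rw [← hy, Matrix.mulVecLin_apply]
      simp only [B]
      rw [Matrix.submatrix_mulVec_equiv]
      rfl
    have h1 := hker _ h0
    ext u
    simpa using congrFun h1 (σ.symm u)
  rw [hgram]
  exact Matrix.PosDef.mul_conjTranspose_self B
    (Matrix.vecMul_injective_iff_isUnit.2 (Matrix.mulVec_injective_iff_isUnit.1 hB))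

end PosDefOfTree

theorem theorem5p2 {V : Type u} [Fintype V] [DecidableEq V] (G : SimpleGraph V)
    [DecidableRel G.Adj] (hG : G.Connected) (v : V) :
    -2 < smallestEigenvalue (modifiedAdjMatrix_isHermitian G v) ↔
      ∃ (W : Type u) (_ : Finite W) (T : SimpleGraph W) (φ : G ≃g T.lineGraph),
        T.IsTree ∧ IsEndEdge T (φ v) := by
  have := hG.nonempty
  rw [neg_two_lt_smallestEigenvalue_iff]
  exact ⟨exists_tree_of_posDef hG, fun ⟨_, _, _, φ, hT, hend⟩ => posDef_of_isTree φ hT hend⟩
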